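/- Let \(\mathbf M\) be a closed symmetric monoidal category, with tensor product \(\otimes\), unit object \(I\) and symmetric braiding \(\tau\), that is complete, cocomplete and additive. Let \(\overline{\mathbf C}=(\mathbf C,\perp)\) be an orthogonal category: a category \(\mathbf C\) with a relation \(\perp\) between morphisms with a common target that is symmetric and satisfies \((g f_1 h_1)\perp(g f_2 h_2)\) whenever \(f_1\perp f_2\) and the composites are defined. Let \(\mathbf{Alg}_{\mathsf{As}}\) be the category of algebras over the associative operad, i.e. of associative and unital algebras \((A,\mu,\eta)\) in \(\mathbf M\), and let \(\mathbf{Alg}_{\mathsf{uLie}}\) be the category of algebras over the unital Lie operad, i.e. of objects \(V\) of \(\mathbf M\) with a bracket \([\cdot,\cdot]:V\otimes V\to V\) and a unit \(\eta:I\to V\) such that the bracket is antisymmetric, \([\cdot,\cdot]=-[\cdot,\cdot]\circ\tau\), satisfies the Jacobi identity, and \([\cdot,\cdot]\circ(\mathrm{id}_V\otimes\eta)=0\). Let \(\phi^*:\mathbf{Alg}_{\mathsf{As}}\to\mathbf{Alg}_{\mathsf{uLie}}\), \((A,\mu,\eta)\mapsto(A,\mu-\mu\circ\tau,\eta)\),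 be the functor induced by the operad map \(\phi:\mathsf{uLie}\to\mathsf{As}\) that sends the unit to the unit and the bracket to the commutator. Let \(\phi_!:\mathbf{Alg}_{\mathsf{uLie}}\to\mathbf{Alg}_{\mathsf{As}}\) be the unital universal enveloping algebra functor: for \(V\in\mathbf{Alg}_{\mathsf{uLie}}\) let \(T^\otimes V=\coprod_{n\ge 0}V^{\otimes n}\) be the tensor algebra, with multiplication \(\mu_\otimes\), unit \(\eta_\otimes\) and inclusion \(\iota_1:V\to T^\otimes V\); let \(\pi:T^\otimes V\to U^\otimes V\) be the coequalizer in \(\mathbf{Alg}_{\mathsf{As}}\) of the algebra morphisms \(T^\otimes(V\otimes V)\rightrightarrows T^\otimes V\) that extend \((\mu_\otimes-\mu_\otimes\circ\tau)\circ(\iota_1\otimes\iota_1)\) and \(\iota_1\circ[\cdot,\cdot]\); and let \(U^\otimes V\to\phi_!(V)\) be the coequalizer in \(\mathbf{Alg}_{\mathsf{As}}\) of the algebra morphisms \(T^\otimes(I)\rightrightarrows U^\otimes V\) that extend \(\pi\circ\iota_1\circ\eta\) and \(\pi\circ\eta_\otimes\). Let \(\mathbf{QFT}(\overline{\mathbf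 C})\) be the full subcategory of the functor category \(\mathbf{Alg}_{\mathsf{As}}^{\mathbf C}\) on the functors \(\mathfrak A\) such that, for all \((f_1:c_1\to c)\perp(f_2:c_2\to c)\), the commutator of \(\mathfrak A(c)\) vanishes after precomposition with \(\mathfrak A(f_1)\otimes\mathfrak A(f_2)\). Let \(\mathbf{LFT}(\overline{\mathbf C})\) be the full subcategory of \(\mathbf{Alg}_{\mathsf{uLie}}^{\mathbf C}\) on the functors \(\mathfrak B\) such that, for all such pairs, the Lie bracket of \(\mathfrak B(c)\) vanishes after precomposition with \(\mathfrak B(f_1)\otimes\mathfrak B(f_2)\). Let \(\mathfrak U_{\mathsf{lin}}:\mathbf{QFT}(\overline{\mathbf C})\to\mathbf{LFT}(\overline{\mathbf C})\), \(\mathfrak A\mapsto\phi^*\circ\mathfrak A\), be the right adjoint of the linear quantization adjunction. Then: 1. \(\phi_!\) is left adjoint to \(\phi^*\). 2. For every \(\mathfrak B\in\mathbf{LFT}(\overline{\mathbf C})\), the functor \(\phi_!\circ\mathfrak B\) belongs to \(\mathbf{QFT}(\overline{\mathbf C})\). 3. The resulting functor \(\mathbf{LFT}(\overline{\mathbf C})\to\mathbf{QFT}(\overline{\mathbf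 C})\), \(\mathfrak B\mapsto\phi_!\circ\mathfrak B\), is left adjoint to \(\mathfrak U_{\mathsf{lin}}\); hence it is a model for the left adjoint \(\mathfrak Q_{\mathsf{lin}}\) of the linear quantization adjunction, i.e. every left adjoint \(\mathfrak Q_{\mathsf{lin}}\) of \(\mathfrak U_{\mathsf{lin}}\) is naturally isomorphic to it. -/

import Mathlib

open CategoryTheory Limits MonoidalCategory

namespace LinearQuantization

universe v u v₁ u₁

set_option linter.unusedSectionVars false

open scoped MonObj

/-! ### Orthogonal categories and field theories -/

/-- An orthogonality relation on a category: a relation between morphisms with a common target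
that is symmetric and stable under pre- and post-composition. A category with an orthogonality
relation is an orthogonal category. -/
structure Orthogonality (C : Type u₁) [Category.{v₁} C] where
  /-- `perp f₁ f₂` is the relation `f₁ ⊥ f₂`. -/
  perp : ∀ {c₁ c₂ c : C}, (c₁ ⟶ c) → (c₂ ⟶ c) → Prop
  symm : ∀ {c₁ c₂ c : C} {f₁ : c₁ ⟶ c} {f₂ : c₂ ⟶ c}, perp f₁ f₂ → perp f₂ f₁
  comp : ∀ {b₁ b₂ c₁ c₂ c d : C} (h₁ : b₁ ⟶ c₁) (h₂ : b₂ ⟶ c₂) {f₁ : c₁ ⟶ c} {f₂ : c₂ ⟶ c}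
    (g : c ⟶ d), perp f₁ f₂ → perp (h₁ ≫ f₁ ≫ g) (h₂ ≫ f₂ ≫ g)

/-- Let `Alg` be a category of algebras with underlying objects in `M` (given by `U`), and let
`r₁`, `r₂` be two operations of arity two, acting on all algebras. A functor `F : C ⥤ Alg` is a
field theory of type `(r₁, r₂)` if both operations agree after precomposition with
`F(f₁) ⊗ F(f₂)`, for all `f₁ ⊥ f₂`. -/
def isFieldTheory {M : Type u} [Category.{v} M] [MonoidalCategory M]
    {Alg : Type*} [Category* Alg] (U : Alg ⥤ M)
    (r₁ r₂ : ∀ A : Alg, U.obj A ⊗ U.obj A ⟶ U.obj A)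
    {C : Type u₁} [Category.{v₁} C] (O : Orthogonality C) : ObjectProperty (C ⥤ Alg) :=
  fun F => ∀ ⦃c₁ c₂ c : C⦄ (f₁ : c₁ ⟶ c) (f₂ : c₂ ⟶ c), O.perp f₁ f₂ →
    (U.map (F.map f₁) ⊗ₘ U.map (F.map f₂)) ≫ r₁ (F.obj c) =
      (U.map (F.map f₁) ⊗ₘ U.map (F.map f₂)) ≫ r₂ (F.obj c)

section TensorAlgebra

variable {M : Type u} [Category.{v} M] [MonoidalCategory M] [SymmetricCategory M]
  [MonoidalClosed M] [HasColimits M]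

/-! ### The tensor algebra -/

/-- The tensor powers `V^{⊗ n}`. -/
def tensorPow (V : M) : ℕ → M
  | 0 => 𝟙_ M
  | n + 1 => V ⊗ tensorPow V n

/-- The (identity) isomorphism `V^{⊗ 0} ≅ 𝟙`. -/
def powZero (V : M) : tensorPow V 0 ≅ 𝟙_ M := Iso.refl _

/-- The (identity) isomorphism `V^{⊗ (n + 1)} ≅ V ⊗ V^{⊗ n}`. -/
def powSucc (V : M) (n : ℕ) : tensorPow V (n + 1) ≅ V ⊗ tensorPow V n := Iso.refl _

/-- The object `T^⊗ V = ∐ₙ V^{⊗ n}`. -/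
noncomputable def tensorAlgObj (V : M) : M := ∐ tensorPow V

/-- The inclusion `V^{⊗ n} ⟶ T^⊗ V`. -/
noncomputable def incl (V : M) (n : ℕ) : tensorPow V n ⟶ tensorAlgObj V := Sigma.ι (tensorPow V) n

/-- A morphism `T^⊗ V ⟶ Z` defined on the summands `V^{⊗ n}`. -/
noncomputable def descT {V Z : M} (f : ∀ n, tensorPow V n ⟶ Z) : tensorAlgObj V ⟶ Z :=
  Sigma.desc f

/-- A morphism `Y ⊗ T^⊗ V ⟶ Z` defined on the summands `Y ⊗ V^{⊗ n}`. -/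
noncomputable def descR {V Y Z : M} (f : ∀ n, Y ⊗ tensorPow V n ⟶ Z) : Y ⊗ tensorAlgObj V ⟶ Z :=
  MonoidalClosed.uncurry (descT fun n => MonoidalClosed.curry (f n))

/-- A morphism `T^⊗ V ⊗ Y ⟶ Z` defined on the summands `V^{⊗ n} ⊗ Y`. -/
noncomputable def descL {V Y Z : M} (f : ∀ n, tensorPow V n ⊗ Y ⟶ Z) : tensorAlgObj V ⊗ Y ⟶ Z :=
  (β_ (tensorAlgObj V) Y).hom ≫ descR fun n => (β_ Y (tensorPow V n)).hom ≫ f n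

lemma incl_descT {V Z : M} (f : ∀ n, tensorPow V n ⟶ Z) (n : ℕ) : incl V n ≫ descT f = f n :=
  Sigma.ι_desc f n

lemma whiskerLeft_incl_descR {V Y Z : M} (f : ∀ n, Y ⊗ tensorPow V n ⟶ Z) (n : ℕ) :
    Y ◁ incl V n ≫ descR f = f n := by
  rw [descR, ← MonoidalClosed.uncurry_natural_left, incl_descT, MonoidalClosed.uncurry_curry]

lemma incl_whiskerRight_descL {V Y Z : M} (f : ∀ n, tensorPow V n ⊗ Y ⟶ Z) (n : ℕ) :
    incl V n ▷ Y ≫ descL f = f n := by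
  rw [descL, BraidedCategory.braiding_naturality_left_assoc, whiskerLeft_incl_descR,
    SymmetricCategory.symmetry_assoc]

lemma hom_ext_T {V Z : M} {f g : tensorAlgObj V ⟶ Z} (h : ∀ n, incl V n ≫ f = incl V n ≫ g) :
    f = g := Sigma.hom_ext _ _ h

lemma hom_ext_R {V Y Z : M} {f g : Y ⊗ tensorAlgObj V ⟶ Z}
    (h : ∀ n, Y ◁ incl V n ≫ f = Y ◁ incl V n ≫ g) : f = g := by
  apply MonoidalClosed.curry_injective
  refine hom_ext_T fun n => ?_
  rw [← MonoidalClosed.curry_natural_left, ← MonoidalClosed.curry_natural_left, h]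

lemma hom_ext_L {V Y Z : M} {f g : tensorAlgObj V ⊗ Y ⟶ Z}
    (h : ∀ n, incl V n ▷ Y ≫ f = incl V n ▷ Y ≫ g) : f = g := by
  rw [← cancel_epi (β_ Y (tensorAlgObj V)).hom]
  refine hom_ext_R fun n => ?_
  rw [BraidedCategory.braiding_naturality_right_assoc,
    BraidedCategory.braiding_naturality_right_assoc, h]

/-- The unit `𝟙 = V^{⊗ 0} ⟶ T^⊗ V`. -/
noncomputable def unitT (V : M) : 𝟙_ M ⟶ tensorAlgObj V := (powZero V).inv ≫ incl V 0

/-- Adding a factor on the left, `V ⊗ T^⊗ V ⟶ T^⊗ V`: it identifies `V ⊗ V^{⊗ n}` with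
`V^{⊗ (n + 1)}`. -/
noncomputable def consT (V : M) : V ⊗ tensorAlgObj V ⟶ tensorAlgObj V :=
  descR fun n => (powSucc V n).inv ≫ incl V (n + 1)

/-- Adding `n` factors on the left, `V^{⊗ n} ⊗ T^⊗ V ⟶ T^⊗ V`. -/
noncomputable def concatT (V : M) : ∀ n, tensorPow V n ⊗ tensorAlgObj V ⟶ tensorAlgObj V
  | 0 => (powZero V).hom ▷ _ ≫ (λ_ (tensorAlgObj V)).hom
  | n + 1 => (powSucc V n).hom ▷ _ ≫ (α_ V (tensorPow V n) (tensorAlgObj V)).hom ≫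
      V ◁ concatT V n ≫ consT V

/-- The multiplication of `T^⊗ V`: concatenation of tensors. -/
noncomputable def mulT (V : M) : tensorAlgObj V ⊗ tensorAlgObj V ⟶ tensorAlgObj V :=
  descL (concatT V)

lemma incl_consT (V : M) (n : ℕ) :
    V ◁ incl V n ≫ consT V = (powSucc V n).inv ≫ incl V (n + 1) :=
  whiskerLeft_incl_descR _ n

lemma incl_mulT (V : M) (n : ℕ) : incl V n ▷ tensorAlgObj V ≫ mulT V = concatT V n :=
  incl_whiskerRight_descL _ n

lemma hom_ext_LR {V X Y Z : M} {f g : X ⊗ (tensorAlgObj V ⊗ Y) ⟶ Z}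
    (h : ∀ n, X ◁ incl V n ▷ Y ≫ f = X ◁ incl V n ▷ Y ≫ g) : f = g := by
  apply MonoidalClosed.curry_injective
  refine hom_ext_L fun n => ?_
  rw [← MonoidalClosed.curry_natural_left, ← MonoidalClosed.curry_natural_left, h]

lemma consT_mulT (V : M) :
    consT V ▷ tensorAlgObj V ≫ mulT V =
      (α_ V (tensorAlgObj V) (tensorAlgObj V)).hom ≫ V ◁ mulT V ≫ consT V := by
  rw [← cancel_epi (α_ V (tensorAlgObj V) (tensorAlgObj V)).inv]
  refine hom_ext_LR fun n => ?_
  rw [Iso.inv_hom_id_assoc, ← MonoidalCategory.whiskerLeft_comp_assoc, incl_mulT,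
    associator_inv_naturality_middle_assoc, ← comp_whiskerRight_assoc, incl_consT,
    comp_whiskerRight_assoc, incl_mulT, concatT]
  simp

lemma concatT_mulT (V : M) (n : ℕ) :
    concatT V n ▷ tensorAlgObj V ≫ mulT V =
      (α_ (tensorPow V n) (tensorAlgObj V) (tensorAlgObj V)).hom ≫ tensorPow V n ◁ mulT V ≫
        concatT V n := by
  induction n with
  | zero =>
    simp only [concatT, comp_whiskerRight, Category.assoc, whisker_exchange_assoc]
    simp
  | succ n ih =>
    simp only [concatT, comp_whiskerRight, Category.assoc, consT_mulT,
      associator_naturality_middle_assoc]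
    rw [← MonoidalCategory.whiskerLeft_comp_assoc, ih, whisker_exchange_assoc]
    simp

lemma concatT_unitT (V : M) (n : ℕ) :
    tensorPow V n ◁ unitT V ≫ concatT V n = (ρ_ (tensorPow V n)).hom ≫ incl V n := by
  induction n with
  | zero =>
    rw [concatT, whisker_exchange_assoc, leftUnitor_naturality, unitT, unitors_equal,
      rightUnitor_naturality_assoc]
    simp
  | succ n ih =>
    rw [concatT, whisker_exchange_assoc, associator_naturality_right_assoc,
      ← MonoidalCategory.whiskerLeft_comp_assoc, ih, MonoidalCategory.whiskerLeft_comp_assoc,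
      incl_consT]
    simp

/-- The tensor algebra `T^⊗ V` as an associative and unital algebra. -/
noncomputable instance (V : M) : MonObj (tensorAlgObj V) where
  one := unitT V
  mul := mulT V
  one_mul := by
    rw [unitT, comp_whiskerRight_assoc, incl_mulT, concatT, ← comp_whiskerRight_assoc]
    simp
  mul_one := by
    refine hom_ext_L fun n => ?_
    rw [← whisker_exchange_assoc, incl_mulT, concatT_unitT, rightUnitor_naturality]
  mul_assoc := by
    rw [← cancel_epi (α_ (tensorAlgObj V) (tensorAlgObj V) (tensorAlgObj V)).inv]
    refine hom_ext_L fun n => ?_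
    rw [Iso.inv_hom_id_assoc, ← whisker_exchange_assoc, incl_mulT,
      associator_inv_naturality_left_assoc, ← comp_whiskerRight_assoc, incl_mulT, concatT_mulT,
      Iso.inv_hom_id_assoc]

/-- The tensor algebra `T^⊗ V`, the free associative and unital algebra on `V`. -/
noncomputable abbrev tensorAlg (V : M) : Mon M := ⟨tensorAlgObj V⟩

/-- The inclusion `ι₁ : V ≅ V^{⊗ 1} ⟶ T^⊗ V`. -/
noncomputable def ι₁ (V : M) : V ⟶ (tensorAlg V).X :=
  (ρ_ V).inv ≫ V ◁ (powZero V).inv ≫ (powSucc V 0).inv ≫ incl V 1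

/-- The morphism `V^{⊗ n} ⟶ A`, `v₁ ⊗ ⋯ ⊗ vₙ ↦ f(v₁) ⋯ f(vₙ)`. -/
noncomputable def liftPow {V : M} (A : Mon M) (f : V ⟶ A.X) : ∀ n, tensorPow V n ⟶ A.X
  | 0 => (powZero V).hom ≫ η[A.X]
  | n + 1 => (powSucc V n).hom ≫ (f ⊗ₘ liftPow A f n) ≫ μ[A.X]

lemma consT_lift {V : M} (A : Mon M) (f : V ⟶ A.X) :
    consT V ≫ descT (liftPow A f) = (f ⊗ₘ descT (liftPow A f)) ≫ μ[A.X] := by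
  refine hom_ext_R fun n => ?_
  rw [← Category.assoc, incl_consT, Category.assoc, incl_descT, liftPow, Iso.inv_hom_id_assoc,
    whiskerLeft_comp_tensorHom_assoc, incl_descT]

lemma concatT_lift {V : M} (A : Mon M) (f : V ⟶ A.X) (n : ℕ) :
    concatT V n ≫ descT (liftPow A f) = (liftPow A f n ⊗ₘ descT (liftPow A f)) ≫ μ[A.X] := by
  induction n with
  | zero =>
    simp only [concatT, liftPow, MonoidalCategory.tensorHom_def, comp_whiskerRight,
      Category.assoc, ← whisker_exchange_assoc, MonObj.one_mul]
    simp [whisker_exchange_assoc]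
  | succ n ih =>
    simp only [concatT, Category.assoc, consT_lift]
    rw [whiskerLeft_comp_tensorHom_assoc, ih]
    simp only [liftPow, MonoidalCategory.tensorHom_def, comp_whiskerRight,
      MonoidalCategory.whiskerLeft_comp, Category.assoc, ← whisker_exchange_assoc,
      MonObj.mul_assoc]
    simp only [whisker_exchange_assoc (powSucc V n).hom, whisker_exchange_assoc f μ[A.X]]
    simp

/-- The extension of `f : V ⟶ A` to an algebra morphism `T^⊗ V ⟶ A`. -/
noncomputable def lift {V : M} {A : Mon M} (f : V ⟶ A.X) : tensorAlg V ⟶ A :=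
  Mon.Hom.mk' (M := tensorAlg V) (N := A) (descT (liftPow A f))
    (by
      change unitT V ≫ _ = _
      rw [unitT, Category.assoc, incl_descT, liftPow, Iso.inv_hom_id_assoc])
    (by
      change mulT V ≫ _ = _
      refine hom_ext_L fun n => ?_
      rw [← Category.assoc, incl_mulT, concatT_lift]
      change _ = incl V n ▷ tensorAlgObj V ≫ (descT (liftPow A f) ⊗ₘ descT (liftPow A f)) ≫ μ[A.X]
      rw [whiskerRight_comp_tensorHom_assoc, incl_descT])

lemma ι₁_lift {V : M} {A : Mon M} (f : V ⟶ A.X) : ι₁ V ≫ (lift f).hom = f := by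
  change ((ρ_ V).inv ≫ V ◁ (powZero V).inv ≫ (powSucc V 0).inv ≫ incl V 1) ≫
    descT (liftPow A f) = f
  simp only [Category.assoc, incl_descT, liftPow, Iso.inv_hom_id_assoc]
  simp [whiskerLeft_comp_tensorHom_assoc]

lemma ι₁_mulT (V : M) : ι₁ V ▷ tensorAlgObj V ≫ mulT V = consT V := by
  have h : (ρ_ V).inv ▷ tensorAlgObj V ≫ (α_ V (𝟙_ M) (tensorAlgObj V)).hom ≫
      V ◁ (λ_ (tensorAlgObj V)).hom = 𝟙 _ := by simp
  simp only [ι₁, comp_whiskerRight, Category.assoc, incl_mulT, concatT,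
    inv_hom_whiskerRight_assoc, associator_naturality_middle_assoc]
  have h' : V ◁ (powZero V).inv ▷ tensorAlgObj V ≫ V ◁ (powZero V).hom ▷ tensorAlgObj V = 𝟙 _ := by
    rw [← MonoidalCategory.whiskerLeft_comp, inv_hom_whiskerRight,
      MonoidalCategory.whiskerLeft_id]
  rw [MonoidalCategory.whiskerLeft_comp_assoc, reassoc_of% h']
  rw [reassoc_of% h]

/-- Algebra morphisms out of `T^⊗ V` are determined by their restriction to `V`. -/
lemma tensorAlg_hom_ext {V : M} {A : Mon M} {f g : tensorAlg V ⟶ A}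
    (h : ι₁ V ≫ f.hom = ι₁ V ≫ g.hom) : f = g := by
  have key : ∀ k : tensorAlg V ⟶ A,
      consT V ≫ k.hom = (ι₁ V ≫ k.hom ⊗ₘ k.hom) ≫ μ[A.X] := fun k => by
    rw [← ι₁_mulT, Category.assoc]
    have : mulT V ≫ k.hom = (k.hom ⊗ₘ k.hom) ≫ μ[A.X] := IsMonHom.mul_hom k.hom
    rw [this]
    exact whiskerRight_comp_tensorHom_assoc _ _ _ _
  apply Mon.Hom.ext
  refine hom_ext_T fun n => ?_
  induction n with
  | zero =>
    rw [← cancel_epi (powZero V).inv, ← Category.assoc, ← Category.assoc]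
    exact (IsMonHom.one_hom f.hom).trans (IsMonHom.one_hom g.hom).symm
  | succ n ih =>
    rw [← cancel_epi (powSucc V n).inv, ← Category.assoc, ← Category.assoc, ← incl_consT,
      Category.assoc, Category.assoc, key f, key g, whiskerLeft_comp_tensorHom_assoc,
      whiskerLeft_comp_tensorHom_assoc, h, ih]

/-! ### Quotient algebras -/

section Quotient

variable {X : M} {A : Mon M} (q₁ q₂ : X ⟶ A.X)

instance whiskerLeft_epi {Y Z W : M} (f : Y ⟶ Z) [Epi f] : Epi (W ◁ f) := by
  have : (tensorLeft W).IsLeftAdjoint := (ihom.adjunction W).isLeftAdjoint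
  exact (inferInstance : Epi ((tensorLeft W).map f))

instance whiskerRight_epi {Y Z W : M} (f : Y ⟶ Z) [Epi f] : Epi (f ▷ W) := by
  have h : f ▷ W = (β_ Y W).hom ≫ W ◁ f ≫ (β_ W Z).hom := by simp
  rw [h]
  infer_instance

/-- The morphism `a ⊗ x ⊗ b ↦ a q(x) b`. -/
def sandwich (q : X ⟶ A.X) : A.X ⊗ (X ⊗ A.X) ⟶ A.X := A.X ◁ (q ▷ A.X ≫ μ[A.X]) ≫ μ[A.X]

lemma whiskerLeft_sandwich (q : X ⟶ A.X) : A.X ◁ sandwich q ≫ μ[A.X] =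
    (α_ A.X A.X (X ⊗ A.X)).inv ≫ μ[A.X] ▷ (X ⊗ A.X) ≫ sandwich q := by
  simp only [sandwich, ← whisker_exchange_assoc, MonObj.mul_assoc]
  simp

lemma sandwich_whiskerRight (q : X ⟶ A.X) : sandwich q ▷ A.X ≫ μ[A.X] =
    (α_ A.X (X ⊗ A.X) A.X).hom ≫ A.X ◁ ((α_ X A.X A.X).hom ≫ X ◁ μ[A.X]) ≫ sandwich q := by
  have h : (q ▷ A.X ≫ μ[A.X]) ▷ A.X ≫ μ[A.X] =
      (α_ X A.X A.X).hom ≫ X ◁ μ[A.X] ≫ q ▷ A.X ≫ μ[A.X] := by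
    rw [comp_whiskerRight_assoc, MonObj.mul_assoc, associator_naturality_left_assoc,
      whisker_exchange_assoc]
  rw [sandwich, comp_whiskerRight_assoc, MonObj.mul_assoc, associator_naturality_middle_assoc,
    ← MonoidalCategory.whiskerLeft_comp_assoc, h]
  simp

/-- The underlying object of the quotient of `A` by the two-sided ideal of relations
`q₁ = q₂`. -/
noncomputable def quotObj : M := coequalizer (sandwich q₁) (sandwich q₂)

/-- The projection to the quotient. -/
noncomputable def proj : A.X ⟶ quotObj q₁ q₂ := coequalizer.π _ _

instance : Epi (proj q₁ q₂) := by
  exact inferInstanceAs (Epi (coequalizer.π (sandwich q₁) (sandwich q₂)))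

lemma sandwich_proj : sandwich q₁ ≫ proj q₁ q₂ = sandwich q₂ ≫ proj q₁ q₂ :=
  coequalizer.condition _ _

lemma exists_desc {Z : M} (k : A.X ⟶ Z) (hk : sandwich q₁ ≫ k = sandwich q₂ ≫ k) :
    ∃ l : quotObj q₁ q₂ ⟶ Z, proj q₁ q₂ ≫ l = k :=
  ⟨coequalizer.desc k hk, coequalizer.π_desc k hk⟩

lemma proj_desc_left {Y Z : M} (k : Y ⊗ A.X ⟶ Z) (hk : Y ◁ sandwich q₁ ≫ k = Y ◁ sandwich q₂ ≫ k) :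
    ∃ l : Y ⊗ quotObj q₁ q₂ ⟶ Z, Y ◁ proj q₁ q₂ ≫ l = k := by
  have hk' : sandwich q₁ ≫ MonoidalClosed.curry k = sandwich q₂ ≫ MonoidalClosed.curry k := by
    rw [← MonoidalClosed.curry_natural_left, hk, MonoidalClosed.curry_natural_left]
  obtain ⟨l, hl⟩ := exists_desc q₁ q₂ _ hk'
  refine ⟨MonoidalClosed.uncurry l, ?_⟩
  rw [← MonoidalClosed.uncurry_natural_left, hl, MonoidalClosed.uncurry_curry]

lemma proj_desc_right {Y Z : M} (k : A.X ⊗ Y ⟶ Z)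
    (hk : sandwich q₁ ▷ Y ≫ k = sandwich q₂ ▷ Y ≫ k) :
    ∃ l : quotObj q₁ q₂ ⊗ Y ⟶ Z, proj q₁ q₂ ▷ Y ≫ l = k := by
  obtain ⟨l, hl⟩ := proj_desc_left q₁ q₂ ((β_ Y A.X).hom ≫ k) (by
    simp only [BraidedCategory.braiding_naturality_right_assoc, hk])
  refine ⟨(β_ _ _).hom ≫ l, ?_⟩
  rw [BraidedCategory.braiding_naturality_left_assoc, hl, SymmetricCategory.symmetry_assoc]

lemma exists_quotMul : ∃ m : quotObj q₁ q₂ ⊗ quotObj q₁ q₂ ⟶ quotObj q₁ q₂,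
    (proj q₁ q₂ ⊗ₘ proj q₁ q₂) ≫ m = μ[A.X] ≫ proj q₁ q₂ := by
  obtain ⟨l, hl⟩ := proj_desc_left q₁ q₂ (μ[A.X] ≫ proj q₁ q₂) (by
    rw [← Category.assoc, ← Category.assoc, whiskerLeft_sandwich, whiskerLeft_sandwich]
    simp only [Category.assoc, sandwich_proj q₁ q₂])
  obtain ⟨m, hm⟩ := proj_desc_right q₁ q₂ l (by
    rw [← cancel_epi (_ ◁ proj q₁ q₂), whisker_exchange_assoc, whisker_exchange_assoc, hl,
      ← Category.assoc, ← Category.assoc, sandwich_whiskerRight, sandwich_whiskerRight]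
    simp only [Category.assoc, sandwich_proj q₁ q₂])
  refine ⟨m, ?_⟩
  rw [MonoidalCategory.tensorHom_def', Category.assoc, hm, hl]

/-- The multiplication of the quotient. -/
noncomputable def quotMul : quotObj q₁ q₂ ⊗ quotObj q₁ q₂ ⟶ quotObj q₁ q₂ :=
  (exists_quotMul q₁ q₂).choose

lemma proj_quotMul : (proj q₁ q₂ ⊗ₘ proj q₁ q₂) ≫ quotMul q₁ q₂ = μ[A.X] ≫ proj q₁ q₂ :=
  (exists_quotMul q₁ q₂).choose_spec

noncomputable instance : MonObj (quotObj q₁ q₂) where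
  one := η[A.X] ≫ proj q₁ q₂
  mul := quotMul q₁ q₂
  one_mul := by
    rw [← cancel_epi (_ ◁ proj q₁ q₂), comp_whiskerRight_assoc, whisker_exchange_assoc,
      ← MonoidalCategory.tensorHom_def'_assoc, proj_quotMul]
    simp
  mul_one := by
    rw [← cancel_epi (proj q₁ q₂ ▷ _), MonoidalCategory.whiskerLeft_comp_assoc,
      ← whisker_exchange_assoc, ← MonoidalCategory.tensorHom_def_assoc, proj_quotMul]
    simp
  mul_assoc := by
    have : Epi ((proj q₁ q₂ ⊗ₘ proj q₁ q₂) ⊗ₘ proj q₁ q₂) := by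
      simp only [MonoidalCategory.tensorHom_def]
      infer_instance
    rw [← cancel_epi ((proj q₁ q₂ ⊗ₘ proj q₁ q₂) ⊗ₘ proj q₁ q₂)]
    rw [tensorHom_comp_whiskerRight_assoc, proj_quotMul, associator_naturality_assoc,
      tensorHom_comp_whiskerLeft_assoc, proj_quotMul,
      ← whiskerRight_comp_tensorHom_assoc, ← whiskerLeft_comp_tensorHom_assoc, proj_quotMul]
    simp

/-- The coequalizer of two algebra morphisms out of a tensor algebra exists. -/
instance hasCoequalizer_lift : HasCoequalizer (lift q₁) (lift q₂) := by
  let Q : Mon M := ⟨quotObj q₁ q₂⟩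
  let p : A ⟶ Q := Mon.Hom.mk' (M := A) (N := Q) (proj q₁ q₂) rfl (proj_quotMul q₁ q₂).symm
  have key : ∀ {B : Mon M} (k : A ⟶ B),
      lift q₁ ≫ k = lift q₂ ≫ k ↔ q₁ ≫ k.hom = q₂ ≫ k.hom := by
    intro B k
    have e : ∀ q : X ⟶ A.X, ι₁ X ≫ (lift q ≫ k).hom = q ≫ k.hom := fun q => by
      rw [Mon.comp_hom', ← Category.assoc, ι₁_lift]
    rw [← e q₁, ← e q₂]
    exact ⟨fun h => by rw [h], tensorAlg_hom_ext⟩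
  have e1 : ∀ {B : Mon M} (k : A ⟶ B) (q : X ⟶ A.X), sandwich q ≫ k.hom =
      (k.hom ⊗ₘ ((q ≫ k.hom) ⊗ₘ k.hom) ≫ μ[B.X]) ≫ μ[B.X] := by
    intro B k q
    have h : (q ▷ A.X ≫ μ[A.X]) ≫ k.hom = ((q ≫ k.hom) ⊗ₘ k.hom) ≫ μ[B.X] := by
      rw [Category.assoc, IsMonHom.mul_hom, whiskerRight_comp_tensorHom_assoc]
    rw [sandwich, Category.assoc, IsMonHom.mul_hom, whiskerLeft_comp_tensorHom_assoc, h]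
  have e2 : ∀ q : X ⟶ A.X,
      ((λ_ X).inv ≫ (η[A.X] ⊗ₘ ((ρ_ X).inv ≫ X ◁ η[A.X]))) ≫ sandwich q = q := by
    intro q
    have h : ((ρ_ X).inv ≫ X ◁ η[A.X]) ≫ q ▷ A.X ≫ μ[A.X] = q := by
      rw [Category.assoc, whisker_exchange_assoc, MonObj.mul_one, rightUnitor_naturality,
        Iso.inv_hom_id_assoc]
    rw [sandwich, Category.assoc, tensorHom_comp_whiskerLeft_assoc, h, MonObj.one_mul_hom,
      Iso.inv_hom_id_assoc]
  have w : lift q₁ ≫ p = lift q₂ ≫ p := by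
    rw [key]
    change q₁ ≫ proj q₁ q₂ = q₂ ≫ proj q₁ q₂
    calc q₁ ≫ proj q₁ q₂ = (_ ≫ sandwich q₁) ≫ proj q₁ q₂ := by rw [e2]
      _ = (_ ≫ sandwich q₂) ≫ proj q₁ q₂ := by
        rw [Category.assoc, sandwich_proj, ← Category.assoc]
      _ = _ := by rw [e2]
  refine HasColimit.mk ⟨Cofork.ofπ p w, Cofork.IsColimit.mk' _ fun s => ?_⟩
  have hs := (key s.π).1 s.condition
  have hs' : sandwich q₁ ≫ s.π.hom = sandwich q₂ ≫ s.π.hom := by rw [e1, e1, hs]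
  have hl := (exists_desc q₁ q₂ _ hs').choose_spec
  set l := (exists_desc q₁ q₂ _ hs').choose
  refine ⟨Mon.Hom.mk' (M := Q) l ?_ ?_, ?_, ?_⟩
  · change (η[A.X] ≫ proj q₁ q₂) ≫ l = _
    rw [Category.assoc, hl]
    exact IsMonHom.one_hom _
  · have : Epi (proj q₁ q₂ ⊗ₘ proj q₁ q₂) := by
      simp only [MonoidalCategory.tensorHom_def]
      infer_instance
    rw [← cancel_epi (proj q₁ q₂ ⊗ₘ proj q₁ q₂)]
    change _ ≫ quotMul q₁ q₂ ≫ l = _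
    rw [← Category.assoc, proj_quotMul, Category.assoc, hl, tensorHom_comp_tensorHom_assoc, hl]
    exact IsMonHom.mul_hom _
  · exact Mon.Hom.ext hl
  · intro m hm
    apply Mon.Hom.ext
    rw [← cancel_epi (proj q₁ q₂)]
    exact (congrArg Mon.Hom.hom hm).trans hl.symm

end Quotient

end TensorAlgebra

/-! ### Unital Lie algebras -/

section Algebras

variable (M : Type u) [Category.{v} M] [MonoidalCategory M] [SymmetricCategory M]

variable {M} in
/-- The cyclic permutation `x₁ ⊗ (x₂ ⊗ x₃) ↦ x₂ ⊗ (x₃ ⊗ x₁)`. -/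
def cyc (X : M) : X ⊗ (X ⊗ X) ⟶ X ⊗ (X ⊗ X) :=
  (β_ X (X ⊗ X)).hom ≫ (α_ X X X).hom

section

variable {M}

lemma cyc_eq (X : M) :
    cyc X = ((α_ X X X).inv ≫ (β_ X X).hom ▷ X ≫ (α_ X X X).hom) ≫ X ◁ (β_ X X).hom := by
  simp [cyc, BraidedCategory.braiding_tensor_right_hom]

lemma swap_swap (X : M) : X ◁ (β_ X X).hom ≫ X ◁ (β_ X X).hom = 𝟙 _ := by
  rw [← MonoidalCategory.whiskerLeft_comp, SymmetricCategory.symmetry,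
    MonoidalCategory.whiskerLeft_id]

lemma swap_swap' (X : M) :
    ((α_ X X X).inv ≫ (β_ X X).hom ▷ X ≫ (α_ X X X).hom) ≫
      ((α_ X X X).inv ≫ (β_ X X).hom ▷ X ≫ (α_ X X X).hom) = 𝟙 _ := by
  simp only [Category.assoc, Iso.hom_inv_id_assoc]
  rw [← comp_whiskerRight_assoc, SymmetricCategory.symmetry]
  simp

lemma cyc_swap_cyc (X : M) : cyc X ≫ X ◁ (β_ X X).hom ≫ cyc X = X ◁ (β_ X X).hom := by
  have h1 := swap_swap X
  have h2 := swap_swap' X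
  rw [cyc_eq]
  generalize X ◁ (β_ X X).hom = t at *
  generalize (α_ X X X).inv ≫ (β_ X X).hom ▷ X ≫ (α_ X X X).hom = a at *
  simp only [Category.assoc]
  rw [← Category.assoc t t, h1, Category.id_comp, ← Category.assoc a a, h2, Category.id_comp]

lemma cyc_cyc_cyc (X : M) : cyc X ≫ cyc X ≫ cyc X = 𝟙 _ := by
  have h1 := swap_swap X
  have h2 := swap_swap' X
  have h3 := BraidedCategory.yang_baxter X X X
  have h4 : ((α_ X X X).inv ≫ (β_ X X).hom ▷ X ≫ (α_ X X X).hom) ≫ X ◁ (β_ X X).hom ≫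
      ((α_ X X X).inv ≫ (β_ X X).hom ▷ X ≫ (α_ X X X).hom) = X ◁ (β_ X X).hom ≫
      ((α_ X X X).inv ≫ (β_ X X).hom ▷ X ≫ (α_ X X X).hom) ≫ X ◁ (β_ X X).hom := by
    simpa only [Category.assoc] using h3
  rw [cyc_eq]
  generalize X ◁ (β_ X X).hom = t at *
  generalize (α_ X X X).inv ≫ (β_ X X).hom ▷ X ≫ (α_ X X X).hom = a at *
  calc (a ≫ t) ≫ (a ≫ t) ≫ a ≫ t = (a ≫ t ≫ a) ≫ t ≫ a ≫ t := by simp only [Category.assoc]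
    _ = t ≫ a ≫ (t ≫ t) ≫ a ≫ t := by rw [h4]; simp only [Category.assoc]
    _ = t ≫ (a ≫ a) ≫ t := by rw [h1]; simp only [Category.assoc, Category.id_comp]
    _ = 𝟙 _ := by rw [h2, Category.id_comp, h1]

end

variable [Preadditive M]

/-- A unital Lie algebra in `M`: an algebra over the unital Lie operad, i.e. an object with a
binary bracket and a unit (the two generators of the operad) which satisfy antisymmetry, the
Jacobi identity and `[x, 1] = 0` (its relations). -/
structure ULieAlg where
  /-- The underlying object. -/
  X : M
  /-- The Lie bracket. -/
  bracket : X ⊗ X ⟶ X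
  /-- The unit. -/
  unit : 𝟙_ M ⟶ X
  antisymm : bracket = -((β_ X X).hom ≫ bracket)
  jacobi : X ◁ bracket ≫ bracket + cyc X ≫ X ◁ bracket ≫ bracket +
    cyc X ≫ cyc X ≫ X ◁ bracket ≫ bracket = 0
  bracket_unit : X ◁ unit ≫ bracket = 0

namespace ULieAlg

variable {M}

/-- Morphisms of unital Lie algebras. -/
@[ext]
structure Hom (V W : ULieAlg M) where
  /-- The underlying morphism. -/
  hom : V.X ⟶ W.X
  bracket_hom : V.bracket ≫ hom = (hom ⊗ₘ hom) ≫ W.bracket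
  unit_hom : V.unit ≫ hom = W.unit

instance : Category (ULieAlg M) where
  Hom V W := Hom V W
  id V := ⟨𝟙 V.X, by simp, by simp⟩
  comp f g := ⟨f.hom ≫ g.hom,
    by rw [← Category.assoc, f.bracket_hom, Category.assoc, g.bracket_hom,
      ← tensorHom_comp_tensorHom, Category.assoc],
    by rw [← Category.assoc, f.unit_hom, g.unit_hom]⟩
  id_comp f := Hom.ext (Category.id_comp f.hom)
  comp_id f := Hom.ext (Category.comp_id f.hom)
  assoc f g h := Hom.ext (Category.assoc f.hom g.hom h.hom)

@[ext]
lemma hom_ext {V W : ULieAlg M} {f g : V ⟶ W} (h : f.hom = g.hom) : f = g := Hom.ext h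

@[simp] lemma id_hom (V : ULieAlg M) : Hom.hom (𝟙 V) = 𝟙 V.X := rfl

@[simp] lemma comp_hom {V W Z : ULieAlg M} (f : V ⟶ W) (g : W ⟶ Z) :
    Hom.hom (f ≫ g) = f.hom ≫ g.hom := rfl

variable (M) in
/-- The forgetful functor to `M`. -/
@[simps]
def forget : ULieAlg M ⥤ M where
  obj V := V.X
  map f := f.hom

end ULieAlg

/-! ### The commutator -/

variable {M}

/-- The commutator `μ - μᵒᵖ` of a monoid object. -/
def commutator (A : M) [MonObj A] : A ⊗ A ⟶ A := μ[A] - (β_ A A).hom ≫ μ[A]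

lemma commutator_jacobi [MonoidalPreadditive M] (A : M) [MonObj A] :
    A ◁ commutator A ≫ commutator A + cyc A ≫ A ◁ commutator A ≫ commutator A +
      cyc A ≫ cyc A ≫ A ◁ commutator A ≫ commutator A = 0 := by
  have e1 : A ◁ μ[A] ≫ (β_ A A).hom ≫ μ[A] = cyc A ≫ A ◁ μ[A] ≫ μ[A] := by
    rw [BraidedCategory.braiding_naturality_right_assoc, MonObj.mul_assoc, cyc, Category.assoc]
  have e0 : A ◁ commutator A = A ◁ μ[A] - A ◁ (β_ A A).hom ≫ A ◁ μ[A] := by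
    rw [← MonoidalCategory.whiskerLeft_comp]
    exact (tensorLeft A).map_sub
  have e2 : A ◁ commutator A ≫ commutator A =
      (𝟙 _ - A ◁ (β_ A A).hom - cyc A + A ◁ (β_ A A).hom ≫ cyc A) ≫ A ◁ μ[A] ≫ μ[A] := by
    rw [e0]
    simp only [commutator, Preadditive.sub_comp, Preadditive.comp_sub, Preadditive.add_comp,
      Category.assoc, e1, Category.id_comp]
    abel
  have h1 := cyc_cyc_cyc A
  have h2 := cyc_swap_cyc A
  rw [e2]
  generalize A ◁ μ[A] ≫ μ[A] = m at *
  generalize A ◁ (β_ A A).hom = t at *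
  generalize cyc A = c at *
  have h3 : ∀ f : A ⊗ A ⊗ A ⟶ A ⊗ A ⊗ A, c ≫ c ≫ c ≫ f = f := fun f => by
    simpa only [Category.assoc, Category.id_comp] using congrArg (· ≫ f) h1
  have h4 : t ≫ c = c ≫ c ≫ t := by
    calc t ≫ c = (c ≫ c ≫ c) ≫ t ≫ c := by rw [h1, Category.id_comp]
      _ = c ≫ c ≫ (c ≫ t ≫ c) := by simp only [Category.assoc]
      _ = _ := by rw [h2]
  rw [← Category.assoc c, ← Category.assoc c, ← Category.assoc c, ← Preadditive.add_comp,
    ← Preadditive.add_comp]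
  convert zero_comp
  simp only [Preadditive.comp_add, Preadditive.comp_sub, Category.comp_id, Category.assoc, h1, h3,
    h4]
  abel

/-- The tensor product of a closed symmetric monoidal additive category is biadditive. -/
lemma monoidalPreadditive [MonoidalClosed M] [HasColimits M] : MonoidalPreadditive M := by
  have : HasBinaryBiproducts M := HasBinaryBiproducts.of_hasBinaryCoproducts
  have key : ∀ X : M, (tensorLeft X).Additive := fun X => by
    have : (tensorLeft X).IsLeftAdjoint := (ihom.adjunction X).isLeftAdjoint
    have : (tensorLeft X).PreservesZeroMorphisms := inferInstance
    have := preservesBinaryBiproducts_of_preservesBinaryCoproducts (tensorLeft X)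
    exact Functor.additive_of_preservesBinaryBiproducts _
  have key' : ∀ X : M, (tensorRight X).Additive := fun X =>
    (Functor.additive_iff_of_iso (BraidedCategory.tensorLeftIsoTensorRight X)).1 (key X)
  exact
    { whiskerLeft_zero := fun {X _ _} => (tensorLeft X).map_zero _ _
      zero_whiskerRight := fun {X _ _} => (tensorRight X).map_zero _ _
      whiskerLeft_add := fun {X _ _} _ _ => (tensorLeft X).map_add
      add_whiskerRight := fun {X _ _} _ _ => (tensorRight X).map_add }

variable [MonoidalClosed M] [HasColimits M]

variable (M) in
/-- The functor `φ^* : Alg_As ⥤ Alg_uLie` induced by the map `φ` from the unital Lie operad to the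
associative operad with `φ(η) = η` and `φ([·,·]) = μ - μᵒᵖ`: it sends an associative and unital
algebra `(A, μ, η)` to the unital Lie algebra `(A, μ - μᵒᵖ, η)`. -/
@[simps]
def phiStar : Mon M ⥤ ULieAlg M where
  obj A :=
    { X := A.X
      bracket := commutator A.X
      unit := η[A.X]
      antisymm := by simp [commutator]
      jacobi := by
        have := monoidalPreadditive (M := M)
        exact commutator_jacobi A.X
      bracket_unit := by simp [commutator] }
  map f :=
    { hom := f.hom
      bracket_hom := by simp [commutator]
      unit_hom := by simp }

/-! ### The unital universal enveloping algebra -/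

namespace ULieAlg

/-- `q₁ = (μ_⊗ - μ_⊗ᵒᵖ) (ι₁ ⊗ ι₁) : V ⊗ V ⟶ T^⊗ V`. -/
noncomputable def q₁ (V : ULieAlg M) : V.X ⊗ V.X ⟶ (tensorAlg V.X).X :=
  (ι₁ V.X ⊗ₘ ι₁ V.X) ≫ commutator (tensorAlg V.X).X

/-- `q₂ = ι₁ [·,·] : V ⊗ V ⟶ T^⊗ V`. -/
noncomputable def q₂ (V : ULieAlg M) : V.X ⊗ V.X ⟶ (tensorAlg V.X).X :=
  V.bracket ≫ ι₁ V.X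

/-- The universal enveloping algebra `U^⊗ V`: the coequalizer of
`q₁, q₂ : T^⊗ (V ⊗ V) ⇉ T^⊗ V` in the category of associative and unital algebras. -/
noncomputable def envAlg (V : ULieAlg M) : Mon M := coequalizer (lift V.q₁) (lift V.q₂)

/-- The projection `π : T^⊗ V ⟶ U^⊗ V`. -/
noncomputable def π (V : ULieAlg M) : tensorAlg V.X ⟶ envAlg V :=
  coequalizer.π (lift V.q₁) (lift V.q₂)

/-- `s₁ = π ι₁ η : 𝟙 ⟶ U^⊗ V`. -/
noncomputable def s₁ (V : ULieAlg M) : 𝟙_ M ⟶ (envAlg V).X := V.unit ≫ ι₁ V.X ≫ V.π.hom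

/-- `s₂ = π η_⊗ : 𝟙 ⟶ U^⊗ V`. -/
noncomputable def s₂ (V : ULieAlg M) : 𝟙_ M ⟶ (envAlg V).X := η[(tensorAlg V.X).X] ≫ V.π.hom

/-- The unital universal enveloping algebra `φ_!(V)`: the coequalizer of
`s₁, s₂ : T^⊗ 𝟙 ⇉ U^⊗ V` in the category of associative and unital algebras. -/
noncomputable def unitalEnvAlg (V : ULieAlg M) : Mon M := coequalizer (lift V.s₁) (lift V.s₂)

/-- The projection `π' : U^⊗ V ⟶ φ_!(V)`. -/
noncomputable def piUnital (V : ULieAlg M) : envAlg V ⟶ unitalEnvAlg V :=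
  coequalizer.π (lift V.s₁) (lift V.s₂)

end ULieAlg

lemma lift_comp {X : M} {A B : Mon M} (f : X ⟶ A.X) (k : A ⟶ B) :
    lift f ≫ k = lift (f ≫ k.hom) := by
  apply tensorAlg_hom_ext
  rw [Mon.comp_hom', ← Category.assoc, ι₁_lift, ι₁_lift]

lemma ι₁_lift_comp {X : M} {A B : Mon M} (f : X ⟶ A.X) (k : A ⟶ B) :
    ι₁ X ≫ (lift f ≫ k).hom = f ≫ k.hom := by
  rw [lift_comp, ι₁_lift]

lemma commutator_hom {A B : Mon M} (k : A ⟶ B) :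
    commutator A.X ≫ k.hom = (k.hom ⊗ₘ k.hom) ≫ commutator B.X := by
  simp [commutator]

/-- `T^⊗` on morphisms. -/
noncomputable def tensorAlgMap {V W : M} (f : V ⟶ W) : tensorAlg V ⟶ tensorAlg W :=
  lift (f ≫ ι₁ W)

namespace ULieAlg

lemma q_condition (V : ULieAlg M) : V.q₁ ≫ V.π.hom = V.q₂ ≫ V.π.hom := by
  rw [← ι₁_lift_comp V.q₁, ← ι₁_lift_comp V.q₂]
  exact congrArg (fun k => ι₁ _ ≫ Mon.Hom.hom k) (coequalizer.condition (lift V.q₁) (lift V.q₂))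

lemma s_condition (V : ULieAlg M) : V.s₁ ≫ V.piUnital.hom = V.s₂ ≫ V.piUnital.hom := by
  rw [← ι₁_lift_comp V.s₁, ← ι₁_lift_comp V.s₂]
  exact congrArg (fun k => ι₁ _ ≫ Mon.Hom.hom k) (coequalizer.condition (lift V.s₁) (lift V.s₂))

/-- `U^⊗` on morphisms. -/
noncomputable def envAlgMap {V W : ULieAlg M} (f : V ⟶ W) : envAlg V ⟶ envAlg W :=
  coequalizer.desc (tensorAlgMap f.hom ≫ W.π) (by
    have h : ι₁ V.X ≫ (tensorAlgMap f.hom).hom = f.hom ≫ ι₁ W.X := ι₁_lift _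
    rw [lift_comp, lift_comp]
    congr 1
    have h1 : V.q₁ ≫ (tensorAlgMap f.hom).hom = (f.hom ⊗ₘ f.hom) ≫ W.q₁ := by
      rw [q₁, q₁, Category.assoc, commutator_hom, tensorHom_comp_tensorHom_assoc, h,
        tensorHom_comp_tensorHom_assoc]
    have h2 : V.q₂ ≫ (tensorAlgMap f.hom).hom = (f.hom ⊗ₘ f.hom) ≫ W.q₂ := by
      rw [q₂, q₂, Category.assoc, h, ← Category.assoc, ← Category.assoc, f.bracket_hom]
    rw [Mon.comp_hom', ← Category.assoc, ← Category.assoc, h1, h2, Category.assoc, Category.assoc,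
      q_condition])

lemma π_envAlgMap {V W : ULieAlg M} (f : V ⟶ W) :
    V.π ≫ envAlgMap f = tensorAlgMap f.hom ≫ W.π :=
  coequalizer.π_desc _ _

/-- `φ_!` on morphisms. -/
noncomputable def unitalEnvAlgMap {V W : ULieAlg M} (f : V ⟶ W) :
    unitalEnvAlg V ⟶ unitalEnvAlg W :=
  coequalizer.desc (envAlgMap f ≫ W.piUnital) (by
    have h : ι₁ V.X ≫ (tensorAlgMap f.hom).hom = f.hom ≫ ι₁ W.X := ι₁_lift _
    have h' : V.π.hom ≫ (envAlgMap f).hom = (tensorAlgMap f.hom).hom ≫ W.π.hom :=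
      congrArg Mon.Hom.hom (π_envAlgMap f)
    rw [lift_comp, lift_comp]
    congr 1
    have h1 : V.s₁ ≫ (envAlgMap f).hom = W.s₁ := by
      rw [s₁, s₁, Category.assoc, Category.assoc, h', ← Category.assoc (ι₁ V.X), h,
        ← f.unit_hom, Category.assoc, Category.assoc]
    have h2 : V.s₂ ≫ (envAlgMap f).hom = W.s₂ := by
      rw [s₂, s₂, Category.assoc, h', ← Category.assoc, IsMonHom.one_hom]
    rw [Mon.comp_hom', ← Category.assoc, ← Category.assoc, h1, h2, s_condition])

lemma piUnital_unitalEnvAlgMap {V W : ULieAlg M} (f : V ⟶ W) :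
    V.piUnital ≫ unitalEnvAlgMap f = envAlgMap f ≫ W.piUnital :=
  coequalizer.π_desc _ _

/-- Algebra morphisms out of `φ_!(V)` are determined by their restriction to `V`. -/
lemma unitalEnvAlg_hom_ext {V : ULieAlg M} {A : Mon M} {f g : unitalEnvAlg V ⟶ A}
    (h : ι₁ V.X ≫ (V.π ≫ V.piUnital ≫ f).hom = ι₁ V.X ≫ (V.π ≫ V.piUnital ≫ g).hom) : f = g :=
  coequalizer.hom_ext (coequalizer.hom_ext (tensorAlg_hom_ext h))

lemma ι₁_unitalEnvAlgMap {V W : ULieAlg M} (f : V ⟶ W) :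
    ι₁ V.X ≫ (V.π ≫ V.piUnital ≫ unitalEnvAlgMap f).hom = f.hom ≫ ι₁ W.X ≫ (W.π ≫ W.piUnital).hom := by
  rw [piUnital_unitalEnvAlgMap, ← Category.assoc V.π, π_envAlgMap, Category.assoc, tensorAlgMap,
    ι₁_lift_comp, Category.assoc]

end ULieAlg

variable (M) in
/-- The unital universal enveloping algebra functor `φ_! : Alg_uLie ⥤ Alg_As`. -/
@[simps]
noncomputable def phiShriek : ULieAlg M ⥤ Mon M where
  obj V := V.unitalEnvAlg
  map f := ULieAlg.unitalEnvAlgMap f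
  map_id V := by
    apply ULieAlg.unitalEnvAlg_hom_ext
    rw [ULieAlg.ι₁_unitalEnvAlgMap]
    simp
  map_comp {V W Z} f g := by
    apply ULieAlg.unitalEnvAlg_hom_ext
    have h := ULieAlg.ι₁_unitalEnvAlgMap f
    have h' := ULieAlg.ι₁_unitalEnvAlgMap g
    simp only [Mon.comp_hom'] at h h'
    rw [ULieAlg.ι₁_unitalEnvAlgMap]
    simp only [Mon.comp_hom', ULieAlg.comp_hom, Category.assoc]
    simp only [← Category.assoc] at h h' ⊢
    rw [h]
    simp only [Category.assoc] at h h' ⊢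
    rw [h']

/-! ### Linear and quantum field theories -/

section FieldTheories

variable (M)
variable {C : Type u₁} [Category.{v₁} C] (O : Orthogonality C)

/-- Quantum field theories: functors `C ⥤ Alg_As` such that
`[A(f₁)(-), A(f₂)(-)] = 0` for all `f₁ ⊥ f₂`. -/
abbrev isQFT : ObjectProperty (C ⥤ Mon M) :=
  isFieldTheory (Mon.forget M) (fun A => commutator A.X) (fun _ => 0) O

/-- Linear field theories: functors `C ⥤ Alg_uLie` such that
`[B(f₁)(-), B(f₂)(-)] = 0` for all `f₁ ⊥ f₂`. -/
abbrev isLFT : ObjectProperty (C ⥤ ULieAlg M) :=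
  isFieldTheory (ULieAlg.forget M) (fun V => V.bracket) (fun _ => 0) O

/-- The category `QFT(C, ⊥)`. -/
abbrev QFT := (isQFT M O).FullSubcategory

/-- The category `LFT(C, ⊥)`. -/
abbrev LFT := (isLFT M O).FullSubcategory

/-- The functor `U_lin : QFT(C, ⊥) ⥤ LFT(C, ⊥)`, i.e. the restriction of
`(φ^*)_* = φ^* ∘ (-)` to field theories. -/
def Ulin : QFT M O ⥤ LFT M O :=
  (isLFT M O).lift ((isQFT M O).ι ⋙ (Functor.whiskeringRight C _ _).obj (phiStar M))
    (fun A => A.property)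

variable {M O} in
/-- Provided that `B ⋙ φ_!` is a quantum field theory for all linear field theories `B`, the
restriction `LFT(C, ⊥) ⥤ QFT(C, ⊥)` of `(φ_!)_* = φ_! ∘ (-)` to field theories. -/
noncomputable def phiShriekRestricted
    (h : ∀ B : C ⥤ ULieAlg M, isLFT M O B → isQFT M O (B ⋙ phiShriek M)) :
    LFT M O ⥤ QFT M O :=
  (isQFT M O).lift ((isLFT M O).ι ⋙ (Functor.whiskeringRight C _ _).obj (phiShriek M))
    (fun B => h B.obj B.property)

end FieldTheories

end Algebras

end LinearQuantization

namespace LinearQuantization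

open scoped MonObj

/-! ### Two-sided ideals generated by relations. -/

section Sandwich

variable {M : Type u} [Category.{v} M] [MonoidalCategory M]

/-! The algebra `φ_!(V)` is the tensor algebra modulo exactly the relations that make `V ⟶ φ_!(V)`
preserve bracket and unit. A morphism of unital Lie algebras `V ⟶ φ^* A` therefore extends to
`φ_!(V) ⟶ A`, and uniquely so since the image of `V` generates. This gives `φ_! ⊣ φ^*`.

For `f₁ ⊥ f₂`, the bracket of `B(c)` vanishes on `B(f₁) ⊗ B(f₂)`, so the images of `B(c₁)` and
`B(c₂)` in `φ_!(B(c))` commute. Whatever commutes with a given generalized element contains the unit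
and is closed under products (`Commutes.one`, `Commutes.mul`). Commutation thus spreads from
generators to the tensor algebra, and then to `φ_!`, once in each variable.

The descent from the tensor algebra to `φ_!` needs the projection to be an epimorphism in `M`, not
merely among algebras. This is `epi_coequalizer_π_hom`: the abstract coequalizer of algebras is a
retract of the explicit quotient by a two-sided ideal, whose projection is a coequalizer in `M`.

Finally, an adjunction induces one between functor categories by postcomposition. Both functors
respect the full subcategories of field theories, so it restricts to them; left adjoints are unique
up to isomorphism. -/

/-- Since `k(a q(x) b) = k(a) k(q(x)) k(b)`, the left side depends on `q` only through `q ≫ k.hom`.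
An algebra morphism that identifies two relations on generators thus identifies them on the whole
ideal. -/
lemma sandwich_comp {X : M} {A B : Mon M} (q : X ⟶ A.X) (k : A ⟶ B) :
    sandwich q ≫ k.hom = (k.hom ⊗ₘ ((q ≫ k.hom) ⊗ₘ k.hom) ≫ μ[B.X]) ≫ μ[B.X] := by
  have h : (q ▷ A.X ≫ μ[A.X]) ≫ k.hom = ((q ≫ k.hom) ⊗ₘ k.hom) ≫ μ[B.X] := by
    rw [Category.assoc, IsMonHom.mul_hom, whiskerRight_comp_tensorHom_assoc]
  rw [sandwich, Category.assoc, IsMonHom.mul_hom, whiskerLeft_comp_tensorHom_assoc, h]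

/-- Setting `a = b = 1` in `a q(x) b`: the ideal contains its generating relations. -/
lemma unit_sandwich {X : M} {A : Mon M} (q : X ⟶ A.X) :
    ((λ_ X).inv ≫ (η[A.X] ⊗ₘ ((ρ_ X).inv ≫ X ◁ η[A.X]))) ≫ sandwich q = q := by
  have h : ((ρ_ X).inv ≫ X ◁ η[A.X]) ≫ q ▷ A.X ≫ μ[A.X] = q := by
    rw [Category.assoc, whisker_exchange_assoc, MonObj.mul_one, rightUnitor_naturality,
      Iso.inv_hom_id_assoc]
  rw [sandwich, Category.assoc, tensorHom_comp_whiskerLeft_assoc, h, MonObj.one_mul_hom,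
    Iso.inv_hom_id_assoc]

end Sandwich

/-! ### Commuting generalized elements, and quotient projections that are epimorphisms in `M`. -/

section Commuting

variable {M : Type u} [Category.{v} M] [MonoidalCategory M] [SymmetricCategory M]

/-- The generalized elements `f` and `g` of the algebra `A` commute. -/
def Commutes (A : M) [MonObj A] {Y Z : M} (f : Y ⟶ A) (g : Z ⟶ A) : Prop :=
  (f ⊗ₘ g) ≫ μ[A] = (β_ Y Z).hom ≫ (g ⊗ₘ f) ≫ μ[A]

namespace Commutes

variable {A : M} [MonObj A] {W Y Z : M} {f : Y ⟶ A} {g : Z ⟶ A}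

lemma symm (h : Commutes A f g) : Commutes A g f := by
  rw [Commutes, h, SymmetricCategory.symmetry_assoc]

lemma precomp (h : Commutes A f g) (k : W ⟶ Z) : Commutes A f (k ≫ g) := by
  rw [Commutes, ← whiskerLeft_comp_tensorHom_assoc, h,
    BraidedCategory.braiding_naturality_right_assoc, whiskerRight_comp_tensorHom_assoc]

lemma one (f : Y ⟶ A) : Commutes A f η[A] := by
  rw [Commutes, MonoidalCategory.tensorHom_def, MonoidalCategory.tensorHom_def']
  simp

/-- Move `f` past one factor at a time, `f(g₁g₂) = (g₁f)g₂ = g₁(fg₂) = (g₁g₂)f`. The hexagon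
identity merges the two braidings into the braiding of `W` with `Y ⊗ Z`. -/
lemma mul {f : W ⟶ A} {g₁ : Y ⟶ A} {g₂ : Z ⟶ A} (h₁ : Commutes A f g₁) (h₂ : Commutes A f g₂) :
    Commutes A f ((g₁ ⊗ₘ g₂) ≫ μ[A]) := by
  have assoc : ∀ {P Q R : M} (p : P ⟶ A) (q : Q ⟶ A) (r : R ⟶ A),
      (((p ⊗ₘ q) ≫ μ[A]) ⊗ₘ r) ≫ μ[A] =
        (α_ P Q R).hom ≫ (p ⊗ₘ ((q ⊗ₘ r) ≫ μ[A])) ≫ μ[A] := by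
    intro P Q R p q r
    rw [← tensorHom_comp_whiskerRight_assoc, MonObj.mul_assoc, associator_naturality_assoc,
      tensorHom_comp_whiskerLeft_assoc]
  have h₁' : (f ⊗ₘ ((g₁ ⊗ₘ g₂) ≫ μ[A])) ≫ μ[A] = (α_ W Y Z).inv ≫ (β_ W Y).hom ▷ Z ≫
      (((g₁ ⊗ₘ f) ≫ μ[A]) ⊗ₘ g₂) ≫ μ[A] := by
    rw [whiskerRight_comp_tensorHom_assoc, ← h₁, assoc, Iso.inv_hom_id_assoc]
  have h₂' : (g₁ ⊗ₘ ((f ⊗ₘ g₂) ≫ μ[A])) ≫ μ[A] = Y ◁ (β_ W Z).hom ≫ (α_ Y Z W).inv ≫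
      (((g₁ ⊗ₘ g₂) ≫ μ[A]) ⊗ₘ f) ≫ μ[A] := by
    rw [assoc, Iso.inv_hom_id_assoc, whiskerLeft_comp_tensorHom_assoc, ← h₂]
  rw [Commutes, h₁', assoc, h₂', BraidedCategory.braiding_tensor_right_hom]
  simp only [Category.assoc]

/-- In a closed category `Y ⊗ -` is a left adjoint, so `Y ◁ k` is again an epimorphism and can be
cancelled. -/
lemma of_precomp_epi [MonoidalClosed M] {k : W ⟶ Z} [Epi k] (h : Commutes A f (k ≫ g)) :
    Commutes A f g := by
  rw [Commutes, ← cancel_epi (Y ◁ k), whiskerLeft_comp_tensorHom_assoc, h,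
    BraidedCategory.braiding_naturality_right_assoc, whiskerRight_comp_tensorHom_assoc]

end Commutes

lemma commutes_iff [Preadditive M] {A Y Z : M} [MonObj A] {f : Y ⟶ A} {g : Z ⟶ A} :
    Commutes A f g ↔ (f ⊗ₘ g) ≫ commutator A = 0 := by
  rw [commutator, Preadditive.comp_sub, sub_eq_zero, BraidedCategory.braiding_naturality_assoc,
    Commutes]

variable [MonoidalClosed M] [HasColimits M]

/-- An algebra morphism out of `T^⊗ V` commutes with `f` if its restriction to `V` does. -/
lemma Commutes.of_tensorAlg {V Y : M} {A : Mon M} {f : Y ⟶ A.X} (k : tensorAlg V ⟶ A)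
    (h : Commutes A.X f (ι₁ V ≫ k.hom)) : Commutes A.X f k.hom := by
  have hk : k = lift (ι₁ V ≫ k.hom) := tensorAlg_hom_ext (ι₁_lift _).symm
  -- By freeness `k` is given on `V^{⊗ n}` by an `n`-fold product: the unit for `n = 0`, one more
  -- factor from `V` at each step.
  have pow : ∀ n, Commutes A.X f (liftPow A (ι₁ V ≫ k.hom) n) := by
    intro n
    induction n with
    | zero => exact (Commutes.one f).precomp _
    | succ n ih => exact (h.mul ih).precomp _
  rw [hk, Commutes]
  -- `Y ⊗ -` preserves the coproduct `T^⊗ V`, so the summands `Y ⊗ V^{⊗ n}` suffice.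
  refine hom_ext_R fun n => ?_
  have e : incl V n ≫ (lift (ι₁ V ≫ k.hom)).hom = liftPow A (ι₁ V ≫ k.hom) n := incl_descT _ n
  have e₁ := pow n
  rw [← e, Commutes] at e₁
  refine (whiskerLeft_comp_tensorHom_assoc _ _ _ _).trans (e₁.trans ?_)
  rw [← whiskerRight_comp_tensorHom_assoc, ← BraidedCategory.braiding_naturality_right_assoc]

/-- The quotient of `A` by the relations `q₁ = q₂`, as an associative and unital algebra. -/
noncomputable abbrev quotAlg {X : M} {A : Mon M} (q₁ q₂ : X ⟶ A.X) : Mon M := ⟨quotObj q₁ q₂⟩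

/-- The projection to the quotient algebra. -/
noncomputable def quotProj {X : M} {A : Mon M} (q₁ q₂ : X ⟶ A.X) : A ⟶ quotAlg q₁ q₂ :=
  Mon.Hom.mk' (M := A) (N := quotAlg q₁ q₂) (proj q₁ q₂) rfl (proj_quotMul q₁ q₂).symm

lemma lift_comp_eq_iff {X : M} {A B : Mon M} (q₁ q₂ : X ⟶ A.X) (k : A ⟶ B) :
    lift q₁ ≫ k = lift q₂ ≫ k ↔ q₁ ≫ k.hom = q₂ ≫ k.hom := by
  have e : ∀ q : X ⟶ A.X, ι₁ X ≫ (lift q ≫ k).hom = q ≫ k.hom := fun q => by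
    rw [Mon.comp_hom', ← Category.assoc, ι₁_lift]
  rw [← e q₁, ← e q₂]
  exact ⟨fun h => by rw [h], tensorAlg_hom_ext⟩

/-- The projection identifies the two sandwiches by construction; inserting units recovers `q₁` and
`q₂` from them. -/
lemma lift_quotProj {X : M} {A : Mon M} (q₁ q₂ : X ⟶ A.X) :
    lift q₁ ≫ quotProj q₁ q₂ = lift q₂ ≫ quotProj q₁ q₂ := by
  rw [lift_comp_eq_iff]
  change q₁ ≫ proj q₁ q₂ = q₂ ≫ proj q₁ q₂
  calc q₁ ≫ proj q₁ q₂ = (_ ≫ sandwich q₁) ≫ proj q₁ q₂ := by rw [unit_sandwich]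
    _ = (_ ≫ sandwich q₂) ≫ proj q₁ q₂ := by
      rw [Category.assoc, sandwich_proj, ← Category.assoc]
    _ = _ := by rw [unit_sandwich]

lemma exists_quotAlg_desc {X : M} {A B : Mon M} (q₁ q₂ : X ⟶ A.X) (k : A ⟶ B)
    (hk : q₁ ≫ k.hom = q₂ ≫ k.hom) : ∃ l : quotAlg q₁ q₂ ⟶ B, quotProj q₁ q₂ ≫ l = k := by
  obtain ⟨l, hl⟩ := exists_desc q₁ q₂ k.hom (by rw [sandwich_comp, sandwich_comp, hk])
  refine ⟨Mon.Hom.mk' (M := quotAlg q₁ q₂) l ?_ ?_, Mon.Hom.ext hl⟩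
  · change (η[A.X] ≫ proj q₁ q₂) ≫ l = _
    rw [Category.assoc, hl]
    exact IsMonHom.one_hom _
  -- Multiplicativity of `l` can be tested on representatives, because whiskering on either side
  -- preserves epimorphisms.
  · have : Epi (proj q₁ q₂ ⊗ₘ proj q₁ q₂) := by
      simp only [MonoidalCategory.tensorHom_def]
      infer_instance
    rw [← cancel_epi (proj q₁ q₂ ⊗ₘ proj q₁ q₂)]
    change _ ≫ quotMul q₁ q₂ ≫ l = _
    rw [← Category.assoc, proj_quotMul, Category.assoc, hl, tensorHom_comp_tensorHom_assoc, hl]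
    exact IsMonHom.mul_hom _

/-- The underlying morphism of the coequalizer of two algebra morphisms out of a tensor algebra
is an epimorphism. -/
lemma epi_coequalizer_π_hom {X : M} {A : Mon M} (q₁ q₂ : X ⟶ A.X) :
    Epi (coequalizer.π (lift q₁) (lift q₂)).hom := by
  obtain ⟨l, hl⟩ := exists_quotAlg_desc q₁ q₂ (coequalizer.π (lift q₁) (lift q₂))
    ((lift_comp_eq_iff _ _ _).1 (coequalizer.condition _ _))
  have hd := coequalizer.π_desc (quotProj q₁ q₂) (lift_quotProj q₁ q₂)
  set d := coequalizer.desc (quotProj q₁ q₂) (lift_quotProj q₁ q₂)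
  -- The comparison `l` from the explicit quotient has section `d`, so `l.hom` is a split
  -- epimorphism and `π = proj ≫ l` is a composite of epimorphisms in `M`. Uniqueness of `l` plays
  -- no role.
  have hdl : d ≫ l = 𝟙 _ := by
    apply coequalizer.hom_ext
    rw [← Category.assoc, hd, hl, Category.comp_id]
  have : IsSplitEpi l.hom := ⟨⟨⟨d.hom, congrArg Mon.Hom.hom hdl⟩⟩⟩
  have hp : Epi (quotProj q₁ q₂).hom := inferInstanceAs (Epi (proj q₁ q₂))
  rw [← hl, Mon.comp_hom']
  exact epi_comp _ _

end Commuting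

/-! ### The universal property of the unital universal enveloping algebra. -/

section EnvelopingAlgebra

variable {M : Type u} [Category.{v} M] [MonoidalCategory M] [SymmetricCategory M]
  [Preadditive M] [MonoidalClosed M] [HasColimits M]

namespace ULieAlg

/-- The projection `T^⊗ V ⟶ φ_!(V)`. -/
noncomputable def tensorProj (V : ULieAlg M) : tensorAlg V.X ⟶ unitalEnvAlg V :=
  V.π ≫ V.piUnital

lemma tensorProj_hom_ext {V : ULieAlg M} {A : Mon M} {f g : unitalEnvAlg V ⟶ A}
    (h : (ι₁ V.X ≫ V.tensorProj.hom) ≫ f.hom = (ι₁ V.X ≫ V.tensorProj.hom) ≫ g.hom) : f = g := by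
  apply unitalEnvAlg_hom_ext
  rw [Category.assoc, Category.assoc] at h
  rw [← Category.assoc V.π, ← Category.assoc V.π]
  exact h

instance epi_tensorProj_hom (V : ULieAlg M) : Epi V.tensorProj.hom := by
  have : Epi V.π.hom := epi_coequalizer_π_hom _ _
  have : Epi V.piUnital.hom := epi_coequalizer_π_hom _ _
  rw [tensorProj, Mon.comp_hom']
  exact epi_comp _ _

/-- An algebra morphism out of `φ_!(V)` commutes with `f` if its restriction to `V` does. -/
lemma commutes_of_unitalEnvAlg {V : ULieAlg M} {Y : M} {A : Mon M} {f : Y ⟶ A.X}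
    (k : unitalEnvAlg V ⟶ A) (h : Commutes A.X f (ι₁ V.X ≫ V.tensorProj.hom ≫ k.hom)) :
    Commutes A.X f k.hom :=
  Commutes.of_precomp_epi (k := V.tensorProj.hom) (Commutes.of_tensorAlg (V.tensorProj ≫ k) h)

/-- This is the relation `q₁ = q₂` of `U^⊗ V`, pushed forward to `φ_!(V)`; algebra morphisms
preserve commutators. -/
lemma bracket_tensorProj (V : ULieAlg M) : V.bracket ≫ ι₁ V.X ≫ V.tensorProj.hom =
    (ι₁ V.X ≫ V.tensorProj.hom ⊗ₘ ι₁ V.X ≫ V.tensorProj.hom) ≫ commutator V.unitalEnvAlg.X := by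
  have h := V.q_condition =≫ V.piUnital.hom
  rw [q₁, q₂, Category.assoc, Category.assoc, Category.assoc, Category.assoc] at h
  have hc := commutator_hom V.tensorProj
  rw [← tensorHom_comp_tensorHom_assoc, ← hc]
  exact h.symm

/-- The canonical morphism `V ⟶ φ^* φ_!(V)`. -/
noncomputable def unitHom (V : ULieAlg M) : V ⟶ (phiStar M).obj ((phiShriek M).obj V) where
  hom := ι₁ V.X ≫ V.tensorProj.hom
  bracket_hom := V.bracket_tensorProj
  unit_hom := by
    -- The second coequalizer identifies the image of the unit of `V` with the unit of the algebra.
    have h := V.s_condition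
    simp only [Category.assoc, s₁, s₂] at h
    change V.unit ≫ ι₁ V.X ≫ V.π.hom ≫ V.piUnital.hom = η[V.unitalEnvAlg.X]
    rw [h, ← Mon.comp_hom', IsMonHom.one_hom]

/-- A morphism of unital Lie algebras `V ⟶ φ^* A` extends to `φ_!(V)`. -/
lemma exists_extension {V : ULieAlg M} {A : Mon M} (f : V ⟶ (phiStar M).obj A) :
    ∃ k : unitalEnvAlg V ⟶ A, ι₁ V.X ≫ (V.tensorProj ≫ k).hom = f.hom := by
  have h : ι₁ V.X ≫ (lift (A := A) f.hom).hom = f.hom := ι₁_lift _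
  -- Descent to `U^⊗ V` amounts to `f` preserving brackets.
  have hq : lift V.q₁ ≫ lift (A := A) f.hom = lift V.q₂ ≫ lift (A := A) f.hom := by
    rw [lift_comp_eq_iff, q₁, q₂, Category.assoc, Category.assoc, commutator_hom,
      tensorHom_comp_tensorHom_assoc, h]
    exact f.bracket_hom.symm
  have hk : V.π ≫ coequalizer.desc _ hq = lift (A := A) f.hom := coequalizer.π_desc _ _
  set k := coequalizer.desc _ hq
  have hk' : V.π.hom ≫ Mon.Hom.hom k = (lift (A := A) f.hom).hom := congrArg Mon.Hom.hom hk
  -- Descent from `U^⊗ V` to `φ_!(V)` amounts to `f` preserving units.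
  have hs : lift V.s₁ ≫ k = lift V.s₂ ≫ k := by
    refine (lift_comp_eq_iff _ _ _).2 ?_
    rw [s₁, s₂, Category.assoc, Category.assoc, Category.assoc]
    erw [hk']
    rw [h, IsMonHom.one_hom]
    exact f.unit_hom
  have hl : V.piUnital ≫ coequalizer.desc _ hs = k := coequalizer.π_desc _ _
  have e : V.tensorProj ≫ coequalizer.desc _ hs = lift (A := A) f.hom :=
    (Category.assoc _ _ _).trans ((congrArg (V.π ≫ ·) hl).trans hk)
  exact ⟨coequalizer.desc _ hs, (congrArg (fun m => ι₁ V.X ≫ Mon.Hom.hom m) e).trans h⟩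

/-- Morphisms out of `φ_!(V)` correspond to morphisms `V ⟶ φ^* A`. -/
noncomputable def envHomEquiv (V : ULieAlg M) (A : Mon M) :
    ((phiShriek M).obj V ⟶ A) ≃ (V ⟶ (phiStar M).obj A) :=
  Equiv.ofBijective (fun k => V.unitHom ≫ (phiStar M).map k)
    ⟨fun _ _ h => tensorProj_hom_ext (congrArg Hom.hom h),
      fun f => by
        obtain ⟨k, hk⟩ := exists_extension f
        refine ⟨k, hom_ext ?_⟩
        rw [← hk]
        exact Category.assoc _ _ _⟩

lemma unitHom_naturality {V W : ULieAlg M} (f : V ⟶ W) :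
    V.unitHom ≫ (phiStar M).map ((phiShriek M).map f) = f ≫ W.unitHom := by
  apply hom_ext
  have h := ι₁_unitalEnvAlgMap f
  rw [← Category.assoc V.π, Mon.comp_hom', ← Category.assoc] at h
  exact h

end ULieAlg

variable (M) in
/-- The adjunction `φ_! ⊣ φ^*`. -/
noncomputable def phiAdjunction : phiShriek M ⊣ phiStar M :=
  Adjunction.mkOfHomEquiv
    { homEquiv := ULieAlg.envHomEquiv
      homEquiv_naturality_left_symm := by
        intro V W A f g
        rw [Equiv.symm_apply_eq]
        -- Writing `g` as the transpose of `k` removes the inverse bijection, which leaves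
        -- naturality of the unit.
        obtain ⟨k, rfl⟩ := (ULieAlg.envHomEquiv W A).surjective g
        rw [Equiv.symm_apply_apply]
        change f ≫ W.unitHom ≫ _ = V.unitHom ≫ (phiStar M).map (_ ≫ _)
        rw [Functor.map_comp, ← Category.assoc V.unitHom, ULieAlg.unitHom_naturality,
          Category.assoc]
      homEquiv_naturality_right := by
        intro V A B f g
        change V.unitHom ≫ _ = (V.unitHom ≫ _) ≫ _
        rw [Functor.map_comp, Category.assoc] }

/-! ### Restriction to field theories. -/

variable {C : Type u₁} [Category.{v₁} C] {O : Orthogonality C}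

/-- The unital universal enveloping algebras of a linear field theory form a quantum field
theory. -/
lemma isQFT_comp_phiShriek (B : C ⥤ ULieAlg M) (hB : isLFT M O B) :
    isQFT M O (B ⋙ phiShriek M) := by
  intro c₁ c₂ c f₁ f₂ hf
  rw [comp_zero]
  have hV : Commutes ((phiShriek M).obj (B.obj c)).X
      (ι₁ (B.obj c₁).X ≫ (B.obj c₁).tensorProj.hom ≫ ((phiShriek M).map (B.map f₁)).hom)
      (ι₁ (B.obj c₂).X ≫ (B.obj c₂).tensorProj.hom ≫ ((phiShriek M).map (B.map f₂)).hom) := by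
    -- Naturality of the unit moves the question into `B(c)`, where the hypothesis on the bracket
    -- applies.
    have e : ∀ {b : C} (f : b ⟶ c), ι₁ (B.obj b).X ≫ (B.obj b).tensorProj.hom ≫
        ((phiShriek M).map (B.map f)).hom = (B.map f).hom ≫ (B.obj c).unitHom.hom := by
      intro b f
      have := congrArg ULieAlg.Hom.hom (ULieAlg.unitHom_naturality (B.map f))
      exact (Category.assoc _ _ _).symm.trans this
    have hb : (B.obj c).bracket ≫ (B.obj c).unitHom.hom =
        ((B.obj c).unitHom.hom ⊗ₘ (B.obj c).unitHom.hom) ≫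
          commutator ((phiShriek M).obj (B.obj c)).X := (B.obj c).unitHom.bracket_hom
    rw [commutes_iff, e, e]
    have h0 : ((B.map f₁).hom ⊗ₘ (B.map f₂).hom) ≫ (B.obj c).bracket = 0 := by
      exact (hB f₁ f₂ hf).trans comp_zero
    have h1 := h0 =≫ (B.obj c).unitHom.hom
    rw [Category.assoc, hb, zero_comp] at h1
    exact (tensorHom_comp_tensorHom_assoc _ _ _ _ _).symm.trans h1
  -- Extend from generators to the enveloping algebra in the second variable, then, by symmetry of
  -- commutation, in the first.
  have h₂ := ULieAlg.commutes_of_unitalEnvAlg ((phiShriek M).map (B.map f₂)) hV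
  have h₁ := ULieAlg.commutes_of_unitalEnvAlg ((phiShriek M).map (B.map f₁)) h₂.symm
  exact (commutes_iff (A := ((phiShriek M).obj (B.obj c)).X)).1 h₁.symm

/-- The restriction of `φ_! ⊣ φ^*` to field theories. -/
noncomputable def fieldTheoryAdjunction
    (h : ∀ B : C ⥤ ULieAlg M, isLFT M O B → isQFT M O (B ⋙ phiShriek M)) :
    phiShriekRestricted h ⊣ Ulin M O :=
  -- The restricted functors agree definitionally with the postcomposition functors after inclusion,
  -- so identity isomorphisms suffice.
  ((phiAdjunction M).whiskerRight C).restrictFullyFaithful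
    (isLFT M O).fullyFaithfulι (isQFT M O).fullyFaithfulι (Iso.refl _) (Iso.refl _)

end EnvelopingAlgebra

end LinearQuantization

theorem corollary5p3 {M : Type*} [Category* M] [MonoidalCategory M] [SymmetricCategory M]
    [MonoidalClosed M] [Preadditive M] [HasLimits M] [HasColimits M]
    {C : Type*} [Category* C] (O : LinearQuantization.Orthogonality C) :
    Nonempty (LinearQuantization.phiShriek M ⊣ LinearQuantization.phiStar M) ∧
    ∃ h : ∀ B : C ⥤ LinearQuantization.ULieAlg M, LinearQuantization.isLFT M O B →
        LinearQuantization.isQFT M O (B ⋙ LinearQuantization.phiShriek M),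
      Nonempty (LinearQuantization.phiShriekRestricted h ⊣ LinearQuantization.Ulin M O) ∧
      ∀ Qlin : LinearQuantization.LFT M O ⥤ LinearQuantization.QFT M O,
        (Qlin ⊣ LinearQuantization.Ulin M O) →
          Nonempty (Qlin ≅ LinearQuantization.phiShriekRestricted h) :=
  ⟨⟨LinearQuantization.phiAdjunction M⟩, LinearQuantization.isQFT_comp_phiShriek,
    ⟨LinearQuantization.fieldTheoryAdjunction _⟩,
    fun _ adj => ⟨adj.leftAdjointUniq (LinearQuantization.fieldTheoryAdjunction _)⟩⟩
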